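/- Throughout, spaces are topological spaces and maps are continuous. For a map $f:E\to B$, the sectional number $\mathrm{sec}(f)\in\{0,1,2,\dots,\infty\}$ (respectively the sectional category $\mathrm{secat}(f)$) is the least cardinality of an open cover of $B$ such that for each member $U$ there is a map $s:U\to E$ with $f\circ s$ equal (respectively homotopic) to the inclusion $U\hookrightarrow B$; it is $\infty$ if there is no finite such cover. For maps $p:E\to B$ and $g:X\to B$, the relative sectional number is $\mathrm{sec}_g(p)=\mathrm{sec}(g^*(p))$, where $g^*(p):\{(x,e)\in X\times E: g(x)=p(e)\}\to X$, $(x,e)\mapsto x$, is the canonical pullback. For a space $Y$ let $F(Y,2)=\{(y_1,y_2)\in Y^2: y_1\neq y_2\}$ with the subspace topology, and let $\pi^Y_{2,1}:F(Y,2)\to Y$, $(y_1,y_2)\mapsto y_1$. The space $Y$ has the fixed point property (FPP) if every map $f:Y\to Y$ has a point $y$ with $f(y)=y$. For a map $g:X\to Y$, the triple $(X,Y;g)$ has the coincidence property (CP) if for every map $f:X\to Y$ there is $x\in X$ with $f(x)=g(x)$. **Proposition.** Let $m\geq 2$, let $Y$ be a (nonempty) connected $m$-dimensional topological manifold without boundary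 (Hausdorff, second countable, and locally homeomorphic to $\mathbb{R}^m$), let $X$ be a space and $g:X\to Y$ a map. 1. If $g$ is a homotopy equivalence, then $\mathrm{secat}(g)=1$. 2. Suppose that $\mathrm{secat}(g)=1$. If $Y$ has the FPP, then $(X,Y;g)$ has the CP and $\mathrm{sec}_g(\pi^Y_{2,1})=2$. Consequently, $Y$ has the FPP if and only if $(X,Y;g)$ has the CP. -/

import Mathlib

/-- `U` carries a local section of `f`: a continuous `s : U → X` with `f ∘ s` equal to the
inclusion `U ↪ Y`. -/
def HasLocalSection {X Y : Type*} [TopologicalSpace X] [TopologicalSpace Y]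
    (f : C(X, Y)) (U : Set Y) : Prop :=
  ∃ s : C(U, X), ∀ y : U, f (s y) = y

/-- `U` carries a homotopy local section of `f`: a continuous `s : U → X` with `f ∘ s` homotopic
to the inclusion `U ↪ Y`. -/
def HasHomotopyLocalSection {X Y : Type*} [TopologicalSpace X] [TopologicalSpace Y]
    (f : C(X, Y)) (U : Set Y) : Prop :=
  ∃ s : C(U, X), (f.comp s).Homotopic ⟨((↑) : U → Y), continuous_subtype_val⟩

/-- `𝒰` is an open cover of `Y` all of whose members satisfy `P`. -/
def IsOpenCoverBy {Y : Type*} [TopologicalSpace Y] (P : Set Y → Prop) (𝒰 : Set (Set Y)) : Prop :=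
  (∀ U ∈ 𝒰, IsOpen U ∧ P U) ∧ ⋃₀ 𝒰 = Set.univ

/-- The sectional number of `f : X → Y`: the least cardinality of an open cover of `Y` whose
members carry local sections of `f` (and `⊤` if there is no finite such cover). -/
noncomputable def sectionalNumber {X Y : Type*} [TopologicalSpace X] [TopologicalSpace Y]
    (f : C(X, Y)) : ℕ∞ :=
  sInf {n | ∃ 𝒰 : Set (Set Y), IsOpenCoverBy (HasLocalSection f) 𝒰 ∧ 𝒰.encard = n}

/-- The sectional category of `f : X → Y`: the least cardinality of an open cover of `Y` whose
members carry homotopy local sections of `f` (and `⊤` if there is no finite such cover). -/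
noncomputable def sectionalCategory {X Y : Type*} [TopologicalSpace X] [TopologicalSpace Y]
    (f : C(X, Y)) : ℕ∞ :=
  sInf {n | ∃ 𝒰 : Set (Set Y), IsOpenCoverBy (HasHomotopyLocalSection f) 𝒰 ∧ 𝒰.encard = n}

/-- The canonical pullback `g^*(p) : X ×_B E → X`, `(x, e) ↦ x`, of `p : E → B` along `g : X → B`,
where `X ×_B E = {(x, e) | g x = p e}`. -/
def canonicalPullback {X E B : Type*} [TopologicalSpace X] [TopologicalSpace E]
    [TopologicalSpace B] (g : C(X, B)) (p : C(E, B)) :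
    C({q : X × E // g q.1 = p q.2}, X) :=
  ⟨fun q => q.1.1, continuous_fst.comp continuous_subtype_val⟩

/-- The sectional number `sec_g(p)` of `p : E → B` relative to `g : X → B`. -/
noncomputable def relativeSectionalNumber {X E B : Type*} [TopologicalSpace X]
    [TopologicalSpace E] [TopologicalSpace B] (g : C(X, B)) (p : C(E, B)) : ℕ∞ :=
  sectionalNumber (canonicalPullback g p)

/-- The ordered configuration space `F(Y, k)` of `k` distinct points of `Y`, a subspace of the
product `Y ^ k`. -/
abbrev OrderedConfigurationSpace (Y : Type*) (k : ℕ) : Type _ :=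
  {y : Fin k → Y // ∀ i j, i ≠ j → y i ≠ y j}

/-- The projection `π_{2,1} : F(Y, 2) → Y` onto the first coordinate (with `F(Y, 1) = Y`). -/
def configurationProjection (Y : Type*) [TopologicalSpace Y] :
    C(OrderedConfigurationSpace Y 2, Y) :=
  ⟨fun y => y.1 0, (continuous_apply 0).comp continuous_subtype_val⟩

/-- The fixed point property. -/
def FixedPointProperty (Y : Type*) [TopologicalSpace Y] : Prop :=
  ∀ f : C(Y, Y), ∃ y : Y, f y = y

/-- The coincidence property of `(X, Y; g)`. -/
def CoincidenceProperty {X Y : Type*} [TopologicalSpace X] [TopologicalSpace Y]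
    (g : C(X, Y)) : Prop :=
  ∀ f : C(X, Y), ∃ x : X, f x = g x

/-! As `Y` is nonempty, `secat(g) = 1` gives a map `s : Y → X` with `g ∘ s` homotopic to the
identity. If `f` never meets `g`, then `f ∘ s` never meets `g ∘ s`. For a manifold, `F(Y, 2) → Y` is
a fibration (Fadell–Neuwirth), so avoidance is transported along the homotopy and yields a self-map
of `Y` avoiding the identity, against the FPP. Conversely, a coincidence of `f ∘ g` with `g` is a
fixed point of `f`. For the sectional number, constant maps give two local sections covering `X`,
while a global section would be a map avoiding `g`.

The lifting is done by hand. `exists_point_pushing` replaces local triviality,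
`IsPushingSubdivision.exists_avoiding` lifts over a small open set of parameters, and
`exists_avoiding_of_homotopy` globalizes as in Hurewicz's uniformization theorem. -/

/-! ### Point pushing in a chart -/

/-- In a Hausdorff locally Euclidean space every point has a neighbourhood `U` with a map `θ`
moving `u ∈ U` to `v ∈ U`, such that no point other than `u` is moved to `v`. -/
theorem exists_point_pushing {E Y : Type*} [NormedAddCommGroup E] [NormedSpace ℝ E]
    [ProperSpace E] [TopologicalSpace Y] [T2Space Y] [ChartedSpace E Y] (b : Y) :
    ∃ U : Set Y, IsOpen U ∧ b ∈ U ∧ ∃ θ : Y × Y × Y → Y,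
      ContinuousOn θ (U ×ˢ U ×ˢ Set.univ) ∧
      (∀ u ∈ U, ∀ v ∈ U, ∀ z, z ≠ u → θ (u, v, z) ≠ v) ∧
      ∀ u ∈ U, ∀ z, θ (u, u, z) = z := by
  classical
  set φ := chartAt E b
  set c := φ b with hc
  have hb : b ∈ φ.source := mem_chart_source E b
  obtain ⟨ε, hε, hεt⟩ := Metric.isOpen_iff.1 φ.open_target c (φ.map_source hb)
  -- Points of `U` are less than `R` apart in the chart; a push is supported within `R` of `u`,
  -- hence inside the `2R`-ball, which it sends into the `3R`-ball.
  obtain ⟨R, hR, hRε⟩ : ∃ R : ℝ, 0 < R ∧ 3 * R < ε := ⟨ε / 4, by linarith, by linarith⟩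
  have h3 : Metric.closedBall c (3 * R) ⊆ φ.target :=
    (Metric.closedBall_subset_ball hRε).trans hεt
  have h2 : Metric.closedBall c (2 * R) ⊆ φ.target :=
    (Metric.closedBall_subset_closedBall (by linarith)).trans h3
  set U : Set Y := φ.source ∩ φ ⁻¹' Metric.ball c (R / 2)
  set K : Set Y := φ.symm '' Metric.closedBall c (2 * R)
  have hKc : IsClosed K :=
    ((isCompact_closedBall c (2 * R)).image_of_continuousOn (φ.continuousOn_symm.mono h2)).isClosed
  have hKs : ∀ z, z ∈ K ↔ z ∈ φ.source ∧ φ z ∈ Metric.closedBall c (2 * R) := by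
    intro z
    constructor
    · rintro ⟨w, hw, rfl⟩
      exact ⟨φ.map_target (h2 hw), by rwa [φ.right_inv (h2 hw)]⟩
    · rintro ⟨hz, hw⟩
      exact ⟨φ z, hw, φ.left_inv hz⟩
  -- A translation by `v - u` damped by a tent function of radius `R` centred at `u`. It need not be
  -- a homeomorphism.
  set T : E → E → E → E := fun u v z => z + max 0 (1 - ‖z - u‖ / R) • (v - u) with hT
  have hTc : Continuous fun p : E × E × E => T p.1 p.2.1 p.2.2 := by
    simp only [hT]; fun_prop
  have hdist : ∀ u ∈ U, ∀ v ∈ U, ‖φ v - φ u‖ < R := by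
    intro u hu v hv
    have h1 := hu.2
    have h1' := hv.2
    simp only [Set.mem_preimage, Metric.mem_ball] at h1 h1'
    rw [← dist_eq_norm]
    linarith [dist_triangle_right (φ v) (φ u) c]
  have hcoef : ∀ x : ℝ, 0 ≤ x → |max 0 (1 - x / R)| ≤ 1 := by
    intro x hx
    rw [abs_of_nonneg (le_max_left _ _)]
    exact max_le zero_le_one (by linarith [div_nonneg hx hR.le])
  have hTmem : ∀ u ∈ U, ∀ v ∈ U, ∀ z ∈ K, T (φ u) (φ v) (φ z) ∈ φ.target := by
    intro u hu v hv z hz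
    apply h3
    have hz2 := ((hKs z).1 hz).2
    rw [Metric.mem_closedBall, dist_eq_norm] at hz2 ⊢
    have : T (φ u) (φ v) (φ z) - c =
        (φ z - c) + max 0 (1 - ‖φ z - φ u‖ / R) • (φ v - φ u) := by
      simp only [hT]; abel
    rw [this]
    refine (norm_add_le _ _).trans ?_
    rw [norm_smul, Real.norm_eq_abs]
    have := mul_le_mul (hcoef _ (norm_nonneg (φ z - φ u))) (hdist u hu v hv).le
      (norm_nonneg _) zero_le_one
    linarith
  have hTid : ∀ u ∈ U, ∀ v, ∀ z ∈ φ.source, φ z ∉ Metric.closedBall c (2 * R) →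
      T (φ u) v (φ z) = φ z := by
    intro u hu v z _ hz2
    have h1 := hu.2
    simp only [Set.mem_preimage, Metric.mem_ball, Metric.mem_closedBall, not_le] at h1 hz2
    have : R ≤ ‖φ z - φ u‖ := by
      rw [← dist_eq_norm]
      linarith [dist_triangle (φ z) (φ u) c]
    have : max 0 (1 - ‖φ z - φ u‖ / R) = 0 :=
      max_eq_left (by linarith [(one_le_div hR).2 this])
    simp [hT, this]
  have hUo : IsOpen U := φ.isOpen_inter_preimage Metric.isOpen_ball
  refine ⟨U, hUo, ⟨hb, by simp [← hc, hR]⟩,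
    fun p => if p.2.2 ∈ K then φ.symm (T (φ p.1) (φ p.2.1) (φ p.2.2)) else p.2.2, ?_, ?_, ?_⟩
  · rintro ⟨u, v, z⟩ ⟨hu, hv, -⟩
    apply ContinuousAt.continuousWithinAt
    have hu' : ContinuousAt (fun p : Y × Y × Y => φ p.1) (u, v, z) :=
      (φ.continuousAt hu.1).comp (f := fun p : Y × Y × Y => p.1) continuousAt_fst
    have hv' : ContinuousAt (fun p : Y × Y × Y => φ p.2.1) (u, v, z) :=
      (φ.continuousAt hv.1).comp (f := fun p : Y × Y × Y => p.2.1) (by fun_prop)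
    by_cases hz : z ∈ K
    · have hzs := ((hKs z).1 hz).1
      have hz' : ContinuousAt (fun p : Y × Y × Y => φ p.2.2) (u, v, z) :=
        (φ.continuousAt hzs).comp (f := fun p : Y × Y × Y => p.2.2) (by fun_prop)
      have hform : ContinuousAt
          (fun p : Y × Y × Y => φ.symm (T (φ p.1) (φ p.2.1) (φ p.2.2))) (u, v, z) := by
        refine ContinuousAt.comp (g := φ.symm)
          (f := fun p : Y × Y × Y => T (φ p.1) (φ p.2.1) (φ p.2.2))
          (φ.continuousAt_symm (hTmem u hu v hv z hz)) ?_
        exact hTc.continuousAt.comp (f := fun p : Y × Y × Y => (φ p.1, φ p.2.1, φ p.2.2))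
          (hu'.prodMk (hv'.prodMk hz'))
      refine hform.congr ?_
      have e1 : ∀ᶠ p : Y × Y × Y in nhds (u, v, z), p.1 ∈ U :=
        continuousAt_fst.eventually (hUo.mem_nhds hu)
      have e2 : ∀ᶠ p : Y × Y × Y in nhds (u, v, z), p.2.2 ∈ φ.source :=
        (show ContinuousAt (fun p : Y × Y × Y => p.2.2) (u, v, z) by fun_prop).eventually
          (φ.open_source.mem_nhds hzs)
      filter_upwards [e1, e2] with p hp1 hp2
      by_cases hp : p.2.2 ∈ K
      · rw [if_pos hp]
      · rw [if_neg hp, hTid _ hp1 _ _ hp2 (fun h => hp ((hKs _).2 ⟨hp2, h⟩)), φ.left_inv hp2]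
    · have hid : ContinuousAt (fun p : Y × Y × Y => p.2.2) (u, v, z) := by fun_prop
      refine hid.congr ?_
      filter_upwards [hid.eventually (hKc.isOpen_compl.mem_nhds hz)] with p hp
      rw [if_neg hp]
  · intro u hu v hv z hzu
    dsimp only
    split_ifs with hz
    · intro heq
      have hzs := ((hKs z).1 hz).1
      have h1 : T (φ u) (φ v) (φ z) = φ v := by
        rw [← φ.right_inv (hTmem u hu v hv z hz), heq]
      have hne : φ z - φ u ≠ 0 := fun h => hzu (φ.injOn hzs hu.1 (sub_eq_zero.1 h))
      have hpos : 0 < ‖φ z - φ u‖ := norm_pos_iff.2 hne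
      -- The tent has slope `1 / R` and `v` is closer than `R` to `u`, so a point `z ≠ u` sent to
      -- `v` would satisfy `‖z - u‖ < ‖z - u‖` in the chart.
      have h4 : φ z - φ u = (1 - max 0 (1 - ‖φ z - φ u‖ / R)) • (φ v - φ u) := by
        rw [sub_smul, one_smul]
        exact (congrArg (· - φ u) (eq_sub_of_add_eq h1)).trans (by abel)
      have h5 : 1 - max 0 (1 - ‖φ z - φ u‖ / R) ≤ ‖φ z - φ u‖ / R := by
        linarith [le_max_right 0 (1 - ‖φ z - φ u‖ / R)]
      have h6 : 0 ≤ 1 - max 0 (1 - ‖φ z - φ u‖ / R) := by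
        have := (abs_le.1 (hcoef _ hpos.le)).2
        linarith
      have h7 : ‖φ z - φ u‖ ≤ ‖φ z - φ u‖ / R * ‖φ v - φ u‖ := by
        conv_lhs => rw [h4]
        rw [norm_smul, Real.norm_eq_abs, abs_of_nonneg h6]
        exact mul_le_mul_of_nonneg_right h5 (norm_nonneg _)
      have h8 : ‖φ z - φ u‖ / R * ‖φ v - φ u‖ < ‖φ z - φ u‖ / R * R :=
        mul_lt_mul_of_pos_left (hdist u hu v hv) (div_pos hpos hR)
      rw [div_mul_cancel₀ _ hR.ne'] at h8
      linarith
    · rintro rfl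
      exact hz ((hKs z).2 ⟨hv.1, Metric.ball_subset_closedBall
        (Metric.ball_subset_ball (by linarith) hv.2)⟩)
  · intro u hu z
    dsimp only
    split_ifs with hz
    · simp only [hT, sub_self, smul_zero, add_zero]
      exact φ.left_inv ((hKs z).1 hz).1
    · rfl

/-! ### Transporting avoidance along a homotopy -/

/-- The conclusion of `exists_point_pushing` for the set `U`. -/
def HasPointPushing {Y : Type*} [TopologicalSpace Y] (U : Set Y) : Prop :=
  ∃ θ : Y × Y × Y → Y, ContinuousOn θ (U ×ˢ U ×ˢ Set.univ) ∧
    (∀ u ∈ U, ∀ v ∈ U, ∀ z, z ≠ u → θ (u, v, z) ≠ v) ∧ ∀ u ∈ U, ∀ z, θ (u, u, z) = z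

/-- A map avoiding `h` at time `τ` can be changed to one avoiding `h` at time `τ'`, if `h` stays
in a set with point pushing where `τ ≠ τ'`. -/
theorem HasPointPushing.exists_avoiding {Z Y : Type*} [TopologicalSpace Z] [TopologicalSpace Y]
    {U : Set Y} (hU : HasPointPushing U) {h : ℝ → Z → Y}
    (hh : Continuous fun p : ℝ × Z => h p.1 p.2) {τ τ' : Z → ℝ} (hτ : Continuous τ)
    (hτ' : Continuous τ') {C : Set Z} (hC : IsClosed C) (hCτ : ∀ z, z ∈ C ∨ τ z = τ' z)
    (hCU : ∀ z ∈ C, h (τ z) z ∈ U ∧ h (τ' z) z ∈ U)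
    {k : Z → Y} (hk : Continuous k) (hkh : ∀ z, k z ≠ h (τ z) z) :
    ∃ k' : Z → Y, Continuous k' ∧ (∀ z, k' z ≠ h (τ' z) z) ∧ ∀ z, τ z = τ' z → k' z = k z := by
  classical
  obtain ⟨θ, hθ, hne, hid⟩ := hU
  -- The closed sets `C` and `{τ = τ'}` cover `Z`, and pushing a point to itself is the identity, so
  -- the two formulas glue continuously.
  set k' : Z → Y := fun z => if z ∈ C then θ (h (τ z) z, h (τ' z) z, k z) else k z with hk'
  have heq : ∀ z, τ z = τ' z → k' z = k z := by
    intro z hz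
    by_cases hzC : z ∈ C
    · simp only [hk', if_pos hzC, ← hz]
      exact hid _ (hCU z hzC).1 _
    · simp only [hk', if_neg hzC]
  refine ⟨k', ?_, fun z => ?_, heq⟩
  · have h1 : ContinuousOn k' C := by
      have hmap : Continuous fun z => (h (τ z) z, h (τ' z) z, k z) :=
        (hh.comp (hτ.prodMk continuous_id)).prodMk
          ((hh.comp (hτ'.prodMk continuous_id)).prodMk hk)
      refine (hθ.comp hmap.continuousOn fun z hz =>
        ⟨(hCU z hz).1, (hCU z hz).2, Set.mem_univ _⟩).congr fun z hz => ?_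
      simp only [hk', if_pos hz, Function.comp_apply]
    have h2 : ContinuousOn k' {z | τ z = τ' z} := hk.continuousOn.congr fun z hz => heq z hz
    have h3 := h1.union_of_isClosed h2 hC (isClosed_eq hτ hτ')
    rwa [show C ∪ {z | τ z = τ' z} = Set.univ from Set.eq_univ_of_forall hCτ,
      continuousOn_univ] at h3
  · by_cases hzC : z ∈ C
    · simp only [hk', if_pos hzC]
      exact hne _ (hCU z hzC).1 _ (hCU z hzC).2 _ (hkh z)
    · have hz := (hCτ z).resolve_left hzC
      rw [heq z hz, ← hz]
      exact hkh z

/-- `t` is a subdivision of `[0, 1]` such that `h` maps each `[t i, t (i + 1)] × N` into a set with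
point pushing. -/
def IsPushingSubdivision {Z Y : Type*} [TopologicalSpace Y] (h : ℝ → Z → Y) (N : Set Z)
    (t : ℕ → ℝ) (n : ℕ) : Prop :=
  t 0 = 0 ∧ t n = 1 ∧ Monotone t ∧ ∀ i < n, ∃ U : Set Y, HasPointPushing U ∧
    ∀ z ∈ N, ∀ s ∈ Set.Icc (t i) (t (i + 1)), h s z ∈ U

/-- Lebesgue's lemma subdivides the path of `z₀`; compactness of each time interval then lets the
same subdivision serve all nearby `z`. -/
theorem exists_isPushingSubdivision {Z Y : Type*} [TopologicalSpace Z] [TopologicalSpace Y]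
    (hY : ∀ b : Y, ∃ U : Set Y, IsOpen U ∧ b ∈ U ∧ HasPointPushing U) {h : ℝ → Z → Y}
    (hh : Continuous fun p : ℝ × Z => h p.1 p.2) (z₀ : Z) :
    ∃ N : Set Z, IsOpen N ∧ z₀ ∈ N ∧ ∃ t n, IsPushingSubdivision h N t n := by
  choose U hUo hbU hUp using hY
  have hc : Continuous fun t : unitInterval => h t z₀ :=
    hh.comp (continuous_subtype_val.prodMk continuous_const)
  obtain ⟨t, ht0, htm, ⟨n, hn⟩, ht⟩ := exists_monotone_Icc_subset_open_cover_unitInterval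
    (c := fun b => (fun t : unitInterval => h t z₀) ⁻¹' U b) (fun b => (hUo b).preimage hc)
    (fun x _ => Set.mem_iUnion.2 ⟨h x z₀, hbU _⟩)
  choose b hb using ht
  have hev : ∀ i, ∀ᶠ z in nhds z₀, ∀ s ∈ Set.Icc (t i : ℝ) (t (i + 1)), h s z ∈ U (b i) := by
    intro i
    refine isCompact_Icc.eventually_forall_of_forall_eventually fun s hs => ?_
    have hs' : s ∈ unitInterval := ⟨(t i).2.1.trans hs.1, hs.2.trans (t (i + 1)).2.2⟩
    have hmem : h s z₀ ∈ U (b i) :=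
      hb i (show (⟨s, hs'⟩ : unitInterval) ∈ Set.Icc (t i) (t (i + 1)) from ⟨hs.1, hs.2⟩)
    exact (hh.comp continuous_swap).continuousAt.eventually
      ((hUo (b i)).mem_nhds (show h s z₀ ∈ U (b i) from hmem))
  have hall : ∀ᶠ z in nhds z₀, ∀ i ∈ Finset.range n,
      ∀ s ∈ Set.Icc (t i : ℝ) (t (i + 1)), h s z ∈ U (b i) :=
    (Filter.eventually_all_finset _).2 fun i _ => hev i
  obtain ⟨N, hN, hNo, hzN⟩ := eventually_nhds_iff.1 hall
  refine ⟨N, hNo, hzN, fun i => t i, n, by simp [ht0], by simp [hn n le_rfl],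
    fun i j hij => htm hij, fun i hi => ⟨U (b i), hUp _, fun z hz s hs =>
      hN z hz i (Finset.mem_range.2 hi) s hs⟩⟩

/-- Time advances through one subdivision interval after another, so each push takes place in a
single set with point pushing. -/
theorem IsPushingSubdivision.exists_avoiding {Z Y : Type*} [TopologicalSpace Z]
    [TopologicalSpace Y] {h : ℝ → Z → Y} (hh : Continuous fun p : ℝ × Z => h p.1 p.2)
    {N C : Set Z} {t : ℕ → ℝ} {n : ℕ} (ht : IsPushingSubdivision h N t n)
    {σ σ' : Z → ℝ} (hσ : Continuous σ) (hσ' : Continuous σ') (h0 : ∀ z, 0 ≤ σ z)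
    (hle : ∀ z, σ z ≤ σ' z) (h1 : ∀ z, σ' z ≤ 1)
    (hC : IsClosed C) (hCN : C ⊆ N) (hCσ : ∀ z, z ∈ C ∨ σ z = σ' z)
    {k : Z → Y} (hk : Continuous k) (hkh : ∀ z, k z ≠ h (σ z) z) :
    ∃ k' : Z → Y, Continuous k' ∧ (∀ z, k' z ≠ h (σ' z) z) ∧ ∀ z, σ z = σ' z → k' z = k z := by
  obtain ⟨ht0, htn, htm, hU⟩ := ht
  -- `t i` clamped to `[σ z, σ' z]`, so that `τ 0 = σ` and `τ n = σ'`.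
  set τ : ℕ → Z → ℝ := fun i z => max (σ z) (min (σ' z) (t i)) with hτ
  have hτc : ∀ i, Continuous (τ i) := fun i => hσ.max (hσ'.min continuous_const)
  have key : ∀ i ≤ n, ∃ k' : Z → Y, Continuous k' ∧ (∀ z, k' z ≠ h (τ i z) z) ∧
      ∀ z, σ z = σ' z → k' z = k z := by
    intro i
    induction i with
    | zero =>
      intro _
      refine ⟨k, hk, fun z => ?_, fun _ _ => rfl⟩
      have : τ 0 z = σ z := by
        simp only [hτ, ht0]
        rw [min_eq_right ((h0 z).trans (hle z)), max_eq_left (h0 z)]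
      rw [this]
      exact hkh z
    | succ i ih =>
      intro hi
      obtain ⟨k₁, hk₁, hkh₁, heq₁⟩ := ih (by omega)
      obtain ⟨U, hUp, hUm⟩ := hU i (by omega)
      have hti : t i ≤ t (i + 1) := htm (Nat.le_succ i)
      obtain ⟨k₂, hk₂, hkh₂, heq₂⟩ := hUp.exists_avoiding hh (hτc i) (hτc (i + 1))
        -- Consecutive clamped times either agree or both lie in `[t i, t (i + 1)]`; only the second
        -- case needs a push.
        (C := C ∩ (τ i ⁻¹' Set.Icc (t i) (t (i + 1)) ∩ τ (i + 1) ⁻¹' Set.Icc (t i) (t (i + 1))))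
        (hC.inter ((isClosed_Icc.preimage (hτc i)).inter (isClosed_Icc.preimage (hτc (i + 1)))))
        (fun z => by
          by_cases hz : σ z = σ' z
          · right
            simp only [hτ, hz]
            rw [max_eq_left (min_le_left _ _), max_eq_left (min_le_left _ _)]
          · have hzC := (hCσ z).resolve_right hz
            have := hle z
            rcases le_total (σ' z) (t i) with h2 | h2
            · right
              simp only [hτ]
              rw [min_eq_left h2, min_eq_left (h2.trans hti)]
            · rcases le_total (t (i + 1)) (σ z) with h3 | h3
              · right
                simp only [hτ]
                rw [max_eq_left ((min_le_right _ _).trans (hti.trans h3)),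
                  max_eq_left ((min_le_right _ _).trans h3)]
              · left
                refine ⟨hzC, ⟨?_, ?_⟩, ⟨?_, ?_⟩⟩ <;> simp only [hτ]
                · exact le_max_of_le_right (le_min h2 le_rfl)
                · exact max_le h3 ((min_le_right _ _).trans hti)
                · exact le_max_of_le_right (le_min h2 hti)
                · exact max_le h3 (min_le_right _ _))
        (fun z hz => ⟨hUm z (hCN hz.1) _ hz.2.1, hUm z (hCN hz.1) _ hz.2.2⟩) hk₁ hkh₁
      refine ⟨k₂, hk₂, hkh₂, fun z hz => ?_⟩
      rw [heq₂ z, heq₁ z hz]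
      simp only [hτ, hz]
      rw [max_eq_left (min_le_left _ _), max_eq_left (min_le_left _ _)]
  obtain ⟨k', hk', hkh', heq'⟩ := key n le_rfl
  refine ⟨k', hk', fun z => ?_, heq'⟩
  have : τ n z = σ' z := by
    simp only [hτ, htn]
    rw [min_eq_left (h1 z), max_eq_right (hle z)]
  rw [← this]
  exact hkh' z

/-- If the initial stage of a homotopy into a space with local point pushing is avoided by some
map, then so is its final stage. -/
theorem exists_avoiding_of_homotopy {Z Y : Type*} [TopologicalSpace Z] [NormalSpace Z]
    [ParacompactSpace Z] [SecondCountableTopology Z] [TopologicalSpace Y]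
    (hY : ∀ b : Y, ∃ U : Set Y, IsOpen U ∧ b ∈ U ∧ HasPointPushing U) {h : ℝ → Z → Y}
    (hh : Continuous fun p : ℝ × Z => h p.1 p.2)
    {k : Z → Y} (hk : Continuous k) (hkh : ∀ z, k z ≠ h 0 z) :
    ∃ k' : Z → Y, Continuous k' ∧ ∀ z, k' z ≠ h 1 z := by
  rcases isEmpty_or_nonempty Z with hZ | ⟨⟨z₁⟩⟩
  · exact ⟨k, hk, fun z => hZ.elim z⟩
  choose N hNo hzN t n ht using exists_isPushingSubdivision hY hh
  obtain ⟨S, hSc, hSu⟩ :=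
    TopologicalSpace.countable_cover_nhds fun z => (hNo z).mem_nhds (hzN z)
  have hSne : S.Nonempty := by
    have : z₁ ∈ ⋃ z ∈ S, N z := hSu ▸ Set.mem_univ z₁
    simp only [Set.mem_iUnion] at this
    exact ⟨_, this.choose_spec.choose⟩
  obtain ⟨p, rfl⟩ := hSc.exists_eq_range hSne
  -- Indexing by `ℕ` orders the cover: the partial sums of `ρ` are times rising from `0` to `1`, the
  -- `i`-th increment being supported in `N (p i)`.
  obtain ⟨ρ, hρ⟩ := PartitionOfUnity.exists_isSubordinate (isClosed_univ (X := Z))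
    (fun i : ℕ => N (p i)) (fun i => hNo _) (by
      rw [← hSu]; simp)
  set σ : ℕ → Z → ℝ := fun i z => ∑ j ∈ Finset.range i, ρ j z with hσ
  have hσc : ∀ i, Continuous (σ i) := fun i => by simp only [hσ]; fun_prop
  have hσs : ∀ i z, σ (i + 1) z = σ i z + ρ i z := fun i z => Finset.sum_range_succ _ _
  have hσ1 : ∀ i z, σ i z ≤ 1 := fun i z => by
    have hfin : (Function.support fun j => ρ j z).Finite := ρ.locallyFinite.point_finite z
    rw [← ρ.sum_eq_one (Set.mem_univ z),
      finsum_eq_sum_of_support_subset (s := Finset.range i ∪ hfin.toFinset) _ (by simp)]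
    exact Finset.sum_le_sum_of_subset_of_nonneg Finset.subset_union_left
      fun j _ _ => ρ.nonneg j z
  have step : ∀ i (k : Z → Y), Continuous k ∧ (∀ z, k z ≠ h (σ i z) z) → ∃ k' : Z → Y,
      (Continuous k' ∧ ∀ z, k' z ≠ h (σ (i + 1) z) z) ∧ ∀ z, ρ i z = 0 → k' z = k z := by
    rintro i k ⟨hk, hkh⟩
    obtain ⟨k', h1, h2, h3⟩ := (ht (p i)).exists_avoiding hh (hσc i) (hσc (i + 1))
      (fun z => Finset.sum_nonneg fun j _ => ρ.nonneg j z)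
      (fun z => by rw [hσs]; linarith [ρ.nonneg i z]) (hσ1 (i + 1)) (isClosed_tsupport (ρ i))
      (hρ i) (fun z => by
        by_cases hz : ρ i z = 0
        · right; rw [hσs, hz, add_zero]
        · left; exact subset_tsupport _ hz) hk hkh
    exact ⟨k', ⟨h1, h2⟩, fun z hz => h3 z (by rw [hσs, hz, add_zero])⟩
  choose next hnext1 hnext2 using step
  let q : ∀ i, {k : Z → Y // Continuous k ∧ ∀ z, k z ≠ h (σ i z) z} := fun i =>
    Nat.rec ⟨k, hk, fun z => by simpa [hσ] using hkh z⟩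
      (fun i k => ⟨next i k.1 k.2, hnext1 i k.1 k.2⟩) i
  have hq : ∀ i z, ρ i z = 0 → (q (i + 1)).1 z = (q i).1 z := fun i z hz =>
    hnext2 i (q i).1 (q i).2 z hz
  have hqc : ∀ z M, (∀ i, M ≤ i → ρ i z = 0) → ∀ i, M ≤ i → (q i).1 z = (q M).1 z := by
    intro z M hM i hi
    induction i, hi using Nat.le_induction with
    | base => rfl
    | succ i hi ih => rw [hq i z (hM i hi), ih]
  have hloc : ∀ z₀, ∃ M : ℕ, ∀ᶠ z in nhds z₀, ∀ i, M ≤ i → ρ i z = 0 := by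
    intro z₀
    obtain ⟨V, hV, hfin⟩ := ρ.locallyFinite z₀
    obtain ⟨M, hM⟩ := hfin.bddAbove
    refine ⟨M + 1, Filter.mem_of_superset hV fun z hz i hi => ?_⟩
    by_contra hne
    have := hM (show i ∈ _ from ⟨z, hne, hz⟩)
    omega
  choose M hM using hloc
  have hMz : ∀ z i, M z ≤ i → ρ i z = 0 := fun z => (hM z).self_of_nhds
  -- Near each point the sequence `q` is eventually constant by local finiteness, so its limit is
  -- continuous; by then the time has reached `1`.
  refine ⟨fun z => (q (M z)).1 z, continuous_iff_continuousAt.2 fun z₀ => ?_, fun z => ?_⟩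
  · refine (q (M z₀)).2.1.continuousAt.congr ?_
    filter_upwards [hM z₀] with z hz
    rw [← hqc z (M z₀) hz _ (le_max_left (M z₀) (M z)),
      ← hqc z (M z) (hMz z) _ (le_max_right (M z₀) (M z))]
  · have : σ (M z) z = 1 := by
      rw [← ρ.sum_eq_one (Set.mem_univ z)]
      refine (finsum_eq_sum_of_support_subset _ fun i hi => ?_).symm
      simp only [Finset.coe_range, Set.mem_Iio]
      by_contra hlt
      exact hi (hMz z i (not_lt.1 hlt))
    have h2 := (q (M z)).2.2 z
    rwa [this] at h2

/-! ### Sectional category and sectional number -/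

/-- An open cover with at most one member has the whole space as a member. -/
theorem IsOpenCoverBy.univ_of_encard_le_one {Y : Type*} [TopologicalSpace Y] [Nonempty Y]
    {P : Set Y → Prop} {𝒰 : Set (Set Y)} (h : IsOpenCoverBy P 𝒰) (h1 : 𝒰.encard ≤ 1) :
    P Set.univ := by
  obtain ⟨y⟩ := ‹Nonempty Y›
  obtain ⟨U, hU, -⟩ : y ∈ ⋃₀ 𝒰 := h.2 ▸ Set.mem_univ y
  have h𝒰 : 𝒰 = {U} := (Set.encard_le_one_iff_subsingleton.1 h1).eq_singleton_of_mem hU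
  have : U = Set.univ := by rw [← h.2, h𝒰, Set.sUnion_singleton]
  exact this ▸ (h.1 U hU).2

theorem one_le_encard_of_isOpenCoverBy {Y : Type*} [TopologicalSpace Y] [Nonempty Y]
    {P : Set Y → Prop} {𝒰 : Set (Set Y)} (h : IsOpenCoverBy P 𝒰) : 1 ≤ 𝒰.encard := by
  obtain ⟨y⟩ := ‹Nonempty Y›
  obtain ⟨U, hU, -⟩ : y ∈ ⋃₀ 𝒰 := h.2 ▸ Set.mem_univ y
  exact Set.one_le_encard_iff_nonempty.2 ⟨U, hU⟩

theorem exists_right_homotopy_inverse_of_sectionalCategory_eq_one {X Y : Type*}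
    [TopologicalSpace X] [TopologicalSpace Y] [Nonempty Y] {g : C(X, Y)}
    (hg : sectionalCategory g = 1) : ∃ s : C(Y, X), (g.comp s).Homotopic (ContinuousMap.id Y) := by
  have hne : {n | ∃ 𝒰 : Set (Set Y), IsOpenCoverBy (HasHomotopyLocalSection g) 𝒰 ∧
      𝒰.encard = n}.Nonempty := by
    by_contra hemp
    rw [Set.not_nonempty_iff_eq_empty] at hemp
    rw [sectionalCategory, hemp, sInf_empty] at hg
    -- The infimum of the empty set is `⊤`, not `1`.
    exact absurd hg (by simp)
  obtain ⟨𝒰, h𝒰, hc⟩ := csInf_mem hne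
  obtain ⟨s, hs⟩ := h𝒰.univ_of_encard_le_one (hc.trans hg).le
  let ι : C(Y, (Set.univ : Set Y)) := ⟨fun y => ⟨y, Set.mem_univ y⟩, by fun_prop⟩
  exact ⟨s.comp ι, hs.comp (ContinuousMap.Homotopic.refl ι)⟩

theorem sectionalCategory_eq_one_of_homotopyEquiv {X Y : Type*}
    [TopologicalSpace X] [TopologicalSpace Y] [Nonempty Y] (e : ContinuousMap.HomotopyEquiv X Y) :
    sectionalCategory e.toFun = 1 := by
  apply le_antisymm
  · refine sInf_le ⟨{Set.univ}, ⟨?_, Set.sUnion_singleton _⟩, Set.encard_singleton _⟩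
    rintro U rfl
    let ι : C((Set.univ : Set Y), Y) := ⟨Subtype.val, continuous_subtype_val⟩
    exact ⟨isOpen_univ, e.invFun.comp ι, e.right_inv.comp (ContinuousMap.Homotopic.refl ι)⟩
  · refine le_sInf ?_
    rintro _ ⟨𝒰, h𝒰, rfl⟩
    exact one_le_encard_of_isOpenCoverBy h𝒰

/-- If `f : U → Y` avoids `g` on `U`, then `U` carries a local section of `g^*(π_{2,1})`. -/
theorem hasLocalSection_of_avoiding {X Y : Type*} [TopologicalSpace X] [TopologicalSpace Y]
    (g : C(X, Y)) {U : Set X} (f : C(U, Y)) (hf : ∀ x : U, f x ≠ g x) :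
    HasLocalSection (canonicalPullback g (configurationProjection Y)) U := by
  refine ⟨⟨fun x => ⟨(x, ⟨![g x, f x], ?_⟩), rfl⟩, ?_⟩, fun x => rfl⟩
  · intro i j hij
    fin_cases i <;> fin_cases j
    · exact absurd rfl hij
    · exact (hf x).symm
    · exact hf x
    · exact absurd rfl hij
  · refine Continuous.subtype_mk (continuous_subtype_val.prodMk
      (Continuous.subtype_mk (continuous_pi fun i => ?_) _)) _
    fin_cases i
    · exact g.continuous.comp continuous_subtype_val
    · exact f.continuous

theorem relativeSectionalNumber_configurationProjection_le_two {X Y : Type*} [TopologicalSpace X]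
    [TopologicalSpace Y] [T1Space Y] [Nontrivial Y] (g : C(X, Y)) :
    relativeSectionalNumber g (configurationProjection Y) ≤ 2 := by
  obtain ⟨a, b, hab⟩ := exists_pair_ne Y
  -- Only an inequality: the two preimages may coincide, for instance when `g` misses both points.
  have hle : ({g ⁻¹' {a}ᶜ, g ⁻¹' {b}ᶜ} : Set (Set X)).encard ≤ 2 := by
    refine (Set.encard_insert_le _ _).trans ?_
    rw [Set.encard_singleton, one_add_one_eq_two]
  refine (show relativeSectionalNumber g (configurationProjection Y) ≤ _ from
    sInf_le ⟨{g ⁻¹' {a}ᶜ, g ⁻¹' {b}ᶜ}, ⟨?_, ?_⟩, rfl⟩).trans hle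
  · have key : ∀ c : Y, IsOpen (g ⁻¹' {c}ᶜ) ∧
        HasLocalSection (canonicalPullback g (configurationProjection Y)) (g ⁻¹' {c}ᶜ) :=
      fun c => ⟨isOpen_compl_singleton.preimage g.continuous,
        hasLocalSection_of_avoiding g (ContinuousMap.const _ c) fun x h => x.2 h.symm⟩
    rintro U (rfl | rfl)
    exacts [key a, key b]
  · rw [Set.sUnion_pair]
    refine Set.eq_univ_of_forall fun x => ?_
    by_cases hx : g x = a
    · right
      intro hxb
      exact hab (hx.symm.trans hxb)
    · exact Or.inl hx

/-- The second coordinate of a global section is a map avoiding `g`. Nonemptiness of `X` rules out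
the empty cover. -/
theorem CoincidenceProperty.two_le_relativeSectionalNumber {X Y : Type*} [TopologicalSpace X]
    [TopologicalSpace Y] [Nonempty X] {g : C(X, Y)} (hg : CoincidenceProperty g) :
    2 ≤ relativeSectionalNumber g (configurationProjection Y) := by
  refine le_sInf ?_
  rintro _ ⟨𝒰, h𝒰, rfl⟩
  by_contra hlt
  have h1 : 𝒰.encard ≤ 1 := by
    rw [not_le, ← one_add_one_eq_two] at hlt
    exact Order.le_of_lt_add_one hlt
  obtain ⟨s, hs⟩ := h𝒰.univ_of_encard_le_one h1
  let f : C(X, Y) := ⟨fun x => (s ⟨x, Set.mem_univ x⟩).1.2.1 1,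
    (continuous_apply 1).comp (continuous_subtype_val.comp (continuous_snd.comp
      (continuous_subtype_val.comp (s.continuous.comp (by fun_prop)))))⟩
  obtain ⟨x, hx⟩ := hg f
  have h2 : (s ⟨x, Set.mem_univ x⟩).1.1 = x := hs ⟨x, Set.mem_univ x⟩
  have h3 := (s ⟨x, Set.mem_univ x⟩).2
  have h4 := (s ⟨x, Set.mem_univ x⟩).1.2.2 1 0 (by decide)
  rw [h2] at h3
  exact h4 (hx.trans h3)

/-! ### Fixed points and coincidences -/

theorem CoincidenceProperty.fixedPointProperty {X Y : Type*} [TopologicalSpace X]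
    [TopologicalSpace Y] {g : C(X, Y)} (hg : CoincidenceProperty g) : FixedPointProperty Y := by
  intro f
  obtain ⟨x, hx⟩ := hg (f.comp g)
  exact ⟨g x, hx⟩

theorem FixedPointProperty.coincidenceProperty {X Y : Type*} [TopologicalSpace X]
    [TopologicalSpace Y] [NormalSpace Y] [ParacompactSpace Y] [SecondCountableTopology Y]
    (hY : ∀ b : Y, ∃ U : Set Y, IsOpen U ∧ b ∈ U ∧ HasPointPushing U)
    (hfpp : FixedPointProperty Y) {g : C(X, Y)} {s : C(Y, X)}
    (hs : (g.comp s).Homotopic (ContinuousMap.id Y)) : CoincidenceProperty g := by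
  intro f
  by_contra! hf
  obtain ⟨H⟩ := hs
  obtain ⟨k, hk, hkh⟩ := exists_avoiding_of_homotopy hY
    -- `projIcc` extends the homotopy constantly to real times.
    (h := fun t y => H (Set.projIcc 0 1 zero_le_one t, y))
    (H.continuous.comp ((continuous_projIcc.comp continuous_fst).prodMk continuous_snd))
    (f.comp s).continuous (fun y => by
      rw [Set.projIcc_left]
      have := H.apply_zero y
      simp only [ContinuousMap.comp_apply] at this ⊢
      intro h
      exact hf (s y) (h.trans this))
  obtain ⟨y, hy⟩ := hfpp ⟨k, hk⟩
  apply hkh y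
  rw [Set.projIcc_right]
  exact hy.trans (H.apply_one y).symm

/-- If `Y` were one point, a chart target would be an open singleton in `E`. -/
theorem nontrivial_of_chartedSpace {E Y : Type*} [NormedAddCommGroup E] [NormedSpace ℝ E]
    [Nontrivial E] [TopologicalSpace Y] [Nonempty Y] [ChartedSpace E Y] : Nontrivial Y := by
  obtain ⟨b⟩ := ‹Nonempty Y›
  by_contra hY
  rw [not_nontrivial_iff_subsingleton] at hY
  have hb := mem_chart_target E b
  have : (chartAt E b).target = {chartAt E b b} := by
    refine Set.Subset.antisymm (fun w hw => ?_) (Set.singleton_subset_iff.2 hb)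
    rw [Set.mem_singleton_iff, ← (chartAt E b).right_inv hw, Subsingleton.elim ((chartAt E b).symm w) b]
  have ho := (chartAt E b).open_target
  rw [this] at ho
  exact not_isOpen_singleton (chartAt E b b) ho

theorem mainTheorem3 {X : Type*} {Y : Type*} [TopologicalSpace X] [TopologicalSpace Y]
    (m : ℕ) (hm : 2 ≤ m)
    [T2Space Y] [SecondCountableTopology Y] [ConnectedSpace Y]
    [ChartedSpace (EuclideanSpace ℝ (Fin m)) Y]
    (g : C(X, Y)) :
    ((∃ e : ContinuousMap.HomotopyEquiv X Y, e.toFun = g) → sectionalCategory g = 1) ∧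
    (sectionalCategory g = 1 →
      (FixedPointProperty Y →
        CoincidenceProperty g ∧
          relativeSectionalNumber g (configurationProjection Y) = 2) ∧
      (FixedPointProperty Y ↔ CoincidenceProperty g)) := by
  -- With Hausdorff and second countable, this gives the paracompactness and normality needed for
  -- partitions of unity.
  have : LocallyCompactSpace Y := ChartedSpace.locallyCompactSpace (EuclideanSpace ℝ (Fin m)) Y
  have : Nontrivial (Fin m) := Fin.nontrivial_iff_two_le.2 hm
  have : Nontrivial Y := nontrivial_of_chartedSpace (E := EuclideanSpace ℝ (Fin m))
  refine ⟨?_, fun hg => ?_⟩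
  · rintro ⟨e, rfl⟩
    exact sectionalCategory_eq_one_of_homotopyEquiv e
  · obtain ⟨s, hs⟩ := exists_right_homotopy_inverse_of_sectionalCategory_eq_one hg
    have : Nonempty X := ‹Nontrivial Y›.to_nonempty.map s
    have hcp : FixedPointProperty Y → CoincidenceProperty g := fun hY =>
      hY.coincidenceProperty (exists_point_pushing (E := EuclideanSpace ℝ (Fin m))) hs
    exact ⟨fun hY => ⟨hcp hY, le_antisymm
      (relativeSectionalNumber_configurationProjection_le_two g)
      (hcp hY).two_le_relativeSectionalNumber⟩, hcp, CoincidenceProperty.fixedPointProperty⟩
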